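/- **Conventions.** A *$\mathrm{Cu}$-semigroup* is a positively ordered commutative monoid $S$ such that (O1) every increasing sequence has a supremum; (O2) every element is the supremum of a $\ll$-increasing sequence; (O3) $x'\ll x$ and $y'\ll y$ imply $x'+y'\ll x+y$; (O4) $\sup_n(x_n+y_n)=\sup_n x_n+\sup_n y_n$ for increasing sequences. Here $x\ll y$ means that whenever $(z_n)_n$ is increasing with supremum $\ge y$, then $x\le z_n$ for some $n$. A *generalized $\mathrm{Cu}$-morphism* is a monoid morphism between $\mathrm{Cu}$-semigroups that preserves order and suprema of increasing sequences; it is a *$\mathrm{Cu}$-morphism* if it also preserves $\ll$. The symbol $\otimes$ denotes the tensor product in the category of $\mathrm{Cu}$-semigroups: the completion, by $\prec$-increasing sequences, of the algebraic tensor product of ordered monoids, where $\prec$ is the auxiliary relation generated by $\sum_i x_i'\otimes y_i'\prec\sum_i x_i\otimes y_i$ for $x_i'\ll x_i$, $y_i'\ll y_i$. A supernatural number is a formal product $q=\prod_p p^{e_p}$ over all primes with $e_p\in\{0,1,\dots,\infty\}$; multiplication adds exponents, and a positive integer $n$ divides $q$ if the exponent of each prime $p$ in $n$ is at most $e_p$.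 Let $K_q\subseteq\mathbb{Q}_{+}$ be the set of fractions $k/n\geq 0$ with $k,n$ coprime and $n$ a positive integer dividing $q$. The Cuntz semigroup of the UHF-algebra $M_q$ of type $q$ is taken in its standard description $$\mathrm{Cu}(M_q)=K_q\sqcup(0,\infty],$$ with the usual order and addition on $K_q$ and on $(0,\infty]$; for $r\in K_q$ and $t\in(0,\infty]$, one has $r\le t$ iff $r<t$ as numbers, $t\le r$ iff $t\leq r$ as numbers, and $r+t\in(0,\infty]$ is the sum of the numbers. The element $1\in \mathrm{Cu}(M_q)$ is $1\in K_q$. A generalized $\mathrm{Cu}$-morphism $\varphi\colon S\to T$ is *$q$-divisible* if for every $x\in S$ and every positive integer $n$ dividing $q$ there is $y\in T$ with $\varphi(x)=ny$; it is *$q$-unperforated* if $\varphi(x)\le\varphi(y)$ whenever $x,y\in S$ satisfy $nx\le ny$ for some positive integer $n$ dividing $q$. **Proposition.** Let $q$ be a supernatural number with $q=q^2$ and $q\neq 1$. Let $\varphi_1\colon S_1\to S_2$ be a $q$-divisible generalized $\mathrm{Cu}$-morphism and let $\varphi_2\colon S_2\to T$ be a $q$-unperforated generalized $\mathrm{Cu}$-morphism.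 Then there exists a generalized $\mathrm{Cu}$-morphism $\gamma\colon S_1\otimes\mathrm{Cu}(M_q)\to T$ such that $\gamma(x\otimes 1)=\varphi_2(\varphi_1(x))$ for every $x\in S_1$. If moreover $\varphi_1$ and $\varphi_2$ are $\mathrm{Cu}$-morphisms, then there exists such a $\gamma$ that is a $\mathrm{Cu}$-morphism. -/

import Mathlib

open scoped NNReal ENNReal

universe u v w

/-! # Abstract Cuntz semigroups -/

/-- `x ≪ y`: whenever an increasing sequence has a supremum `s` with `y ≤ s`, some term of the
sequence dominates `x`. -/
def WayBelow {S : Type u} [Preorder S] (x y : S) : Prop :=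
  ∀ z : ℕ → S, Monotone z → ∀ s : S, IsLUB (Set.range z) s → y ≤ s → ∃ n, x ≤ z n

/-- A `Cu`-semigroup: a positively ordered commutative monoid satisfying (O1)-(O4). -/
class CuSemigroup (S : Type u) extends AddCommMonoid S, PartialOrder S where
  add_le_add_right' : ∀ a b : S, a ≤ b → ∀ c : S, a + c ≤ b + c
  zero_le' : ∀ a : S, 0 ≤ a
  /-- (O1) every increasing sequence has a supremum -/
  O1 : ∀ z : ℕ → S, Monotone z → ∃ s, IsLUB (Set.range z) s
  /-- (O2) every element is the supremum of a `≪`-increasing sequence -/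
  O2 : ∀ a : S, ∃ z : ℕ → S, (∀ n, WayBelow (z n) (z (n + 1))) ∧ IsLUB (Set.range z) a
  /-- (O3) addition is compatible with `≪` -/
  O3 : ∀ a' a b' b : S, WayBelow a' a → WayBelow b' b → WayBelow (a' + b') (a + b)
  /-- (O4) addition is compatible with suprema of increasing sequences -/
  O4 : ∀ y z : ℕ → S, Monotone y → Monotone z → ∀ a b : S,
    IsLUB (Set.range y) a → IsLUB (Set.range z) b → IsLUB (Set.range fun n => y n + z n) (a + b)

/-- A generalized `Cu`-morphism: an order-preserving monoid morphism that preserves suprema of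
increasing sequences. -/
structure IsGenCuMorphism {S : Type u} {T : Type v} [CuSemigroup S] [CuSemigroup T]
    (f : S → T) : Prop where
  map_zero : f 0 = 0
  map_add : ∀ a b, f (a + b) = f a + f b
  monotone : Monotone f
  map_sup : ∀ z : ℕ → S, Monotone z → ∀ s, IsLUB (Set.range z) s →
    IsLUB (Set.range fun n => f (z n)) (f s)

/-- A `Cu`-morphism: a generalized `Cu`-morphism that preserves `≪`. -/
structure IsCuMorphism {S : Type u} {T : Type v} [CuSemigroup S] [CuSemigroup T]
    (f : S → T) : Prop extends IsGenCuMorphism f where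
  map_wayBelow : ∀ a b, WayBelow a b → WayBelow (f a) (f b)

/-! # Supernatural numbers and `q`-rational morphisms -/

/-- Supernatural numbers `∏ p ^ (e p)`, `e p ∈ {0, 1, …, ∞}`, encoded by their exponents.
Multiplication adds exponents; the number `1` has all exponents `0`. -/
abbrev Supernatural : Type := Multiplicative (Nat.Primes → ℕ∞)

/-- The exponent of the prime `p` in `q`. -/
def Supernatural.exponent (q : Supernatural) (p : Nat.Primes) : ℕ∞ := Multiplicative.toAdd q p

/-- The positive natural number `n` is a (finite) divisor of `q`. -/
def Supernatural.IsDivisor (n : ℕ) (q : Supernatural) : Prop :=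
  n ≠ 0 ∧ ∀ p : Nat.Primes, (n.factorization p : ℕ∞) ≤ q.exponent p

/-- `φ` is `q`-divisible. -/
def IsQDivisible (q : Supernatural) {S : Type u} {T : Type v} [CuSemigroup S] [CuSemigroup T]
    (φ : S → T) : Prop :=
  ∀ x : S, ∀ n : ℕ, Supernatural.IsDivisor n q → ∃ y : T, φ x = n • y

/-- `φ` is `q`-unperforated. -/
def IsQUnperforated (q : Supernatural) {S : Type u} {T : Type v} [CuSemigroup S] [CuSemigroup T]
    (φ : S → T) : Prop :=
  ∀ x y : S, ∀ n : ℕ, Supernatural.IsDivisor n q → n • x ≤ n • y → φ x ≤ φ y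

/-! # Facts about `≪` -/

section WayBelowFacts

variable {S : Type u} [CuSemigroup S]

instance (priority := 100) CuSemigroup.toIsOrderedAddMonoid : IsOrderedAddMonoid S where
  add_le_add_left a b h c := CuSemigroup.add_le_add_right' a b h c

theorem WayBelow.le {x y : S} (h : WayBelow x y) : x ≤ y := by
  obtain ⟨n, hn⟩ := h (fun _ => y) monotone_const y (by simp) le_rfl
  exact hn

theorem WayBelow.of_le_left {x x' y : S} (h : x ≤ x') (h' : WayBelow x' y) : WayBelow x y :=
  fun z hz s hs hy => let ⟨n, hn⟩ := h' z hz s hs hy; ⟨n, h.trans hn⟩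

theorem WayBelow.of_le_right {x y y' : S} (h : WayBelow x y) (h' : y ≤ y') : WayBelow x y' :=
  fun z hz s hs hy => h z hz s hs (h'.trans hy)

theorem WayBelow.zero (x : S) : WayBelow 0 x := fun _ _ _ _ _ => ⟨0, CuSemigroup.zero_le' _⟩

theorem CuSemigroup.exists_seq (a : S) : ∃ z : ℕ → S, Monotone z ∧
    (∀ n, WayBelow (z n) (z (n + 1))) ∧ (∀ n, WayBelow (z n) a) ∧ IsLUB (Set.range z) a := by
  obtain ⟨z, hz, ha⟩ := CuSemigroup.O2 a
  exact ⟨z, monotone_nat_of_le_succ fun n => (hz n).le, hz,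
    fun n => (hz n).of_le_right (ha.1 ⟨n + 1, rfl⟩), ha⟩

theorem WayBelow.exists_between {x y : S} (h : WayBelow x y) :
    ∃ z, WayBelow x z ∧ WayBelow z y := by
  obtain ⟨z, hm, hz, hy, hl⟩ := CuSemigroup.exists_seq y
  obtain ⟨n, hn⟩ := h z hm y hl le_rfl
  exact ⟨z (n + 1), (hz n).of_le_left hn, hy _⟩

theorem WayBelow.exists_add {x a b : S} (h : WayBelow x (a + b)) :
    ∃ a' b', WayBelow a' a ∧ WayBelow b' b ∧ x ≤ a' + b' := by
  obtain ⟨y, hym, -, hya, hyl⟩ := CuSemigroup.exists_seq a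
  obtain ⟨z, hzm, -, hzb, hzl⟩ := CuSemigroup.exists_seq b
  obtain ⟨n, hn⟩ := h _ (hym.add hzm) _ (CuSemigroup.O4 y z hym hzm a b hyl hzl) le_rfl
  exact ⟨y n, z n, hya n, hzb n, hn⟩

theorem WayBelow.exists_upper {x y a : S} (hx : WayBelow x a) (hy : WayBelow y a) :
    ∃ c, WayBelow c a ∧ x ≤ c ∧ y ≤ c := by
  obtain ⟨z, hm, -, hz, hl⟩ := CuSemigroup.exists_seq a
  obtain ⟨n, hn⟩ := hx z hm a hl le_rfl
  obtain ⟨m, hm'⟩ := hy z hm a hl le_rfl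
  exact ⟨z (max n m), hz _, hn.trans (hm (le_max_left _ _)), hm'.trans (hm (le_max_right _ _))⟩

end WayBelowFacts

/-! # The tensor product of `Cu`-semigroups

On formal sums `∑ xᵢ ⊙ yᵢ` (multisets of pairs) consider the smallest additive preorder for which
`⊙` is biadditive and monotone, together with the auxiliary relation `≺` generated by it and
by the relation `∑ xᵢ' ⊙ yᵢ' ≺ ∑ xᵢ ⊙ yᵢ` for `xᵢ' ≪ xᵢ` and `yᵢ' ≪ yᵢ`. The tensor product in the
category `Cu` is the completion of the resulting (pre)ordered monoid with auxiliary relation by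
`≺`-increasing sequences. The class of such a sequence `f₀ ≺ f₁ ≺ ⋯` is represented by the set
of all `h` with `h ≺ fₙ` for some `n`; the sets that arise are exactly the countably
generated round ideals. -/

section Tensor

variable {S : Type u} {T : Type v} [CuSemigroup S] [CuSemigroup T]

/-- The smallest additive preorder on formal sums for which `⊙` is monotone and biadditive. -/
inductive TensorLE : Multiset (S × T) → Multiset (S × T) → Prop
  | refl (f) : TensorLE f f
  | trans {f g h} : TensorLE f g → TensorLE g h → TensorLE f h
  | add_right {f g} (h) : TensorLE f g → TensorLE (f + h) (g + h)
  | mono {x x' : S} {y y' : T} : x ≤ x' → y ≤ y' → TensorLE {(x, y)} {(x', y')}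
  | add_fst_le (x x' : S) (y : T) : TensorLE {(x + x', y)} ({(x, y)} + {(x', y)})
  | le_add_fst (x x' : S) (y : T) : TensorLE ({(x, y)} + {(x', y)}) {(x + x', y)}
  | add_snd_le (x : S) (y y' : T) : TensorLE {(x, y + y')} ({(x, y)} + {(x, y')})
  | le_add_snd (x : S) (y y' : T) : TensorLE ({(x, y)} + {(x, y')}) {(x, y + y')}
  | zero_fst_le (y : T) : TensorLE {((0 : S), y)} 0
  | le_zero_fst (y : T) : TensorLE 0 {((0 : S), y)}
  | zero_snd_le (x : S) : TensorLE {(x, (0 : T))} 0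
  | le_zero_snd (x : S) : TensorLE 0 {(x, (0 : T))}

/-- Componentwise `≪` on pairs. -/
def PairWayBelow (a b : S × T) : Prop := WayBelow a.1 b.1 ∧ WayBelow a.2 b.2

/-- The auxiliary relation `≺` on formal sums. `Multiset.Rel R f g` says that the terms of `f`
and `g` can be matched bijectively such that matched terms are related by `R`. -/
def TensorPrec (f g : Multiset (S × T)) : Prop :=
  ∃ f' g', TensorLE f f' ∧ Multiset.Rel PairWayBelow f' g' ∧ TensorLE g' g

theorem TensorLE.add {f g f' g' : Multiset (S × T)} (h : TensorLE f g) (h' : TensorLE f' g') :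
    TensorLE (f + f') (g + g') := by
  refine (h.add_right f').trans ?_
  rw [add_comm g, add_comm g]
  exact h'.add_right g

theorem TensorLE.of_rel {f g : Multiset (S × T)} (h : Multiset.Rel PairWayBelow f g) :
    TensorLE f g := by
  induction h with
  | zero => exact .refl _
  | cons hab _ ih =>
    rw [← Multiset.singleton_add, ← Multiset.singleton_add]
    exact (TensorLE.mono hab.1.le hab.2.le).add ih

theorem TensorLE.zero_le (f : Multiset (S × T)) : TensorLE 0 f := by
  induction f using Multiset.induction with
  | empty => exact .refl _
  | cons a f ih =>
    rw [← Multiset.singleton_add, ← zero_add (0 : Multiset (S × T))]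
    exact ((TensorLE.le_zero_fst a.2).trans (.mono (CuSemigroup.zero_le' _) le_rfl)).add ih

theorem rel_singleton_right {f : Multiset (S × T)} {a : S × T}
    (h : Multiset.Rel PairWayBelow f {a}) : ∃ b, PairWayBelow b a ∧ f = {b} := by
  rw [← Multiset.cons_zero, Multiset.rel_cons_right] at h
  obtain ⟨b, g, hb, hg, rfl⟩ := h
  rw [Multiset.rel_zero_right] at hg
  subst hg
  exact ⟨b, hb, rfl⟩

theorem rel_pair {x x' : S} {y y' : T} (hx : WayBelow x x') (hy : WayBelow y y') :
    Multiset.Rel PairWayBelow {(x, y)} {(x', y')} :=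
  Multiset.Rel.cons (show PairWayBelow (x, y) (x', y') from ⟨hx, hy⟩) Multiset.Rel.zero

/-- The preorder can be moved past the termwise way-below relation. -/
theorem TensorLE.exists_rel {g g' : Multiset (S × T)} (h : TensorLE g' g) :
    ∀ f', Multiset.Rel PairWayBelow f' g' →
      ∃ f, TensorLE f' f ∧ Multiset.Rel PairWayBelow f g := by
  induction h with
  | refl f => exact fun f' hf => ⟨f', .refl _, hf⟩
  | trans _ _ ih₁ ih₂ =>
    intro f' hf
    obtain ⟨f₁, h₁, h₁'⟩ := ih₁ f' hf
    obtain ⟨f₂, h₂, h₂'⟩ := ih₂ f₁ h₁'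
    exact ⟨f₂, h₁.trans h₂, h₂'⟩
  | add_right h _ ih =>
    intro f' hf
    obtain ⟨a, b, ha, hb, rfl⟩ := Multiset.rel_add_right.mp hf
    obtain ⟨c, hc, hc'⟩ := ih a ha
    exact ⟨c + b, hc.add_right b, hc'.add hb⟩
  | mono hx hy =>
    intro f' hf
    obtain ⟨b, hb, rfl⟩ := rel_singleton_right hf
    exact ⟨{b}, .refl _, rel_pair (hb.1.of_le_right hx) (hb.2.of_le_right hy)⟩
  | add_fst_le x x' y =>
    intro f' hf
    obtain ⟨⟨a, b⟩, hb, rfl⟩ := rel_singleton_right hf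
    obtain ⟨c, d, hc, hd, hcd⟩ := WayBelow.exists_add hb.1
    exact ⟨{(c, b)} + {(d, b)}, (TensorLE.mono hcd le_rfl).trans (.add_fst_le _ _ _),
      (rel_pair hc hb.2).add (rel_pair hd hb.2)⟩
  | le_add_fst x x' y =>
    intro f' hf
    obtain ⟨p, r, hp, hr, rfl⟩ := Multiset.rel_add_right.mp hf
    obtain ⟨⟨a, b⟩, hb, rfl⟩ := rel_singleton_right hp
    obtain ⟨⟨c, d⟩, hd, rfl⟩ := rel_singleton_right hr
    obtain ⟨e, he, hbe, hde⟩ := WayBelow.exists_upper hb.2 hd.2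
    exact ⟨{(a + c, e)}, ((TensorLE.mono le_rfl hbe).add (.mono le_rfl hde)).trans
      (.le_add_fst _ _ _), rel_pair (CuSemigroup.O3 _ _ _ _ hb.1 hd.1) he⟩
  | add_snd_le x y y' =>
    intro f' hf
    obtain ⟨⟨a, b⟩, hb, rfl⟩ := rel_singleton_right hf
    obtain ⟨c, d, hc, hd, hcd⟩ := WayBelow.exists_add hb.2
    exact ⟨{(a, c)} + {(a, d)}, (TensorLE.mono le_rfl hcd).trans (.add_snd_le _ _ _),
      (rel_pair hb.1 hc).add (rel_pair hb.1 hd)⟩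
  | le_add_snd x y y' =>
    intro f' hf
    obtain ⟨p, r, hp, hr, rfl⟩ := Multiset.rel_add_right.mp hf
    obtain ⟨⟨a, b⟩, hb, rfl⟩ := rel_singleton_right hp
    obtain ⟨⟨c, d⟩, hd, rfl⟩ := rel_singleton_right hr
    obtain ⟨e, he, hae, hce⟩ := WayBelow.exists_upper hb.1 hd.1
    exact ⟨{(e, b + d)}, ((TensorLE.mono hae le_rfl).add (.mono hce le_rfl)).trans
      (.le_add_snd _ _ _), rel_pair he (CuSemigroup.O3 _ _ _ _ hb.2 hd.2)⟩
  | zero_fst_le y =>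
    intro f' hf
    obtain ⟨⟨a, b⟩, hb, rfl⟩ := rel_singleton_right hf
    exact ⟨0, (TensorLE.mono hb.1.le le_rfl).trans (.zero_fst_le _), Multiset.Rel.zero⟩
  | le_zero_fst y =>
    intro f' hf
    rw [Multiset.rel_zero_right] at hf
    subst hf
    exact ⟨{(0, 0)}, .le_zero_fst _, rel_pair (.zero _) (.zero _)⟩
  | zero_snd_le y =>
    intro f' hf
    obtain ⟨⟨a, b⟩, hb, rfl⟩ := rel_singleton_right hf
    exact ⟨0, (TensorLE.mono le_rfl hb.2.le).trans (.zero_snd_le _), Multiset.Rel.zero⟩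
  | le_zero_snd y =>
    intro f' hf
    rw [Multiset.rel_zero_right] at hf
    subst hf
    exact ⟨{(0, 0)}, .le_zero_snd _, rel_pair (.zero _) (.zero _)⟩

theorem tensorPrec_iff {f g : Multiset (S × T)} :
    TensorPrec f g ↔ ∃ f', TensorLE f f' ∧ Multiset.Rel PairWayBelow f' g := by
  constructor
  · rintro ⟨f', g', h₁, h₂, h₃⟩
    obtain ⟨e, he, he'⟩ := h₃.exists_rel f' h₂
    exact ⟨e, h₁.trans he, he'⟩
  · rintro ⟨f', h₁, h₂⟩
    exact ⟨f', g, h₁, h₂, .refl _⟩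

theorem TensorPrec.le {f g : Multiset (S × T)} (h : TensorPrec f g) : TensorLE f g := by
  obtain ⟨f', g', h₁, h₂, h₃⟩ := h
  exact h₁.trans ((TensorLE.of_rel h₂).trans h₃)

theorem TensorPrec.of_le_left {f f' g : Multiset (S × T)} (h : TensorLE f f')
    (h' : TensorPrec f' g) : TensorPrec f g := by
  obtain ⟨a, b, h₁, h₂, h₃⟩ := h'
  exact ⟨a, b, h.trans h₁, h₂, h₃⟩

theorem TensorPrec.of_le_right {f g g' : Multiset (S × T)} (h : TensorPrec f g)
    (h' : TensorLE g g') : TensorPrec f g' := by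
  obtain ⟨a, b, h₁, h₂, h₃⟩ := h
  exact ⟨a, b, h₁, h₂, h₃.trans h'⟩

theorem TensorPrec.add {f g f' g' : Multiset (S × T)} (h : TensorPrec f g)
    (h' : TensorPrec f' g') : TensorPrec (f + f') (g + g') := by
  obtain ⟨a, b, h₁, h₂, h₃⟩ := h
  obtain ⟨c, d, h₄, h₅, h₆⟩ := h'
  exact ⟨a + c, b + d, h₁.add h₄, h₂.add h₅, h₃.add h₆⟩

/-- Every formal sum is approximated by a termwise `≪`-increasing sequence. -/
theorem exists_rel_seq (g : Multiset (S × T)) : ∃ c : ℕ → Multiset (S × T),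
    (∀ n, Multiset.Rel PairWayBelow (c n) (c (n + 1))) ∧
    (∀ n, Multiset.Rel PairWayBelow (c n) g) ∧
    ∀ f, Multiset.Rel PairWayBelow f g → ∃ N, ∀ n, N ≤ n → TensorLE f (c n) := by
  induction g using Multiset.induction with
  | empty =>
    refine ⟨fun _ => 0, fun _ => .zero, fun _ => .zero, fun f hf => ⟨0, fun n _ => ?_⟩⟩
    rw [Multiset.rel_zero_right] at hf
    subst hf
    exact .refl _
  | cons a g ih =>
    obtain ⟨c, h₁, h₂, h₃⟩ := ih
    obtain ⟨y, hym, hy, hya, hyl⟩ := CuSemigroup.exists_seq a.1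
    obtain ⟨z, hzm, hz, hza, hzl⟩ := CuSemigroup.exists_seq a.2
    refine ⟨fun n => (y n, z n) ::ₘ c n, fun n => .cons ⟨hy n, hz n⟩ (h₁ n),
      fun n => .cons ⟨hya n, hza n⟩ (h₂ n), fun f hf => ?_⟩
    obtain ⟨b, f', hb, hf', rfl⟩ := Multiset.rel_cons_right.mp hf
    obtain ⟨k, hk⟩ := hb.1 y hym _ hyl le_rfl
    obtain ⟨l, hl⟩ := hb.2 z hzm _ hzl le_rfl
    obtain ⟨N, hN⟩ := h₃ f' hf'
    refine ⟨max N (max k l), fun n hn => ?_⟩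
    change TensorLE (b ::ₘ f') ((y n, z n) ::ₘ c n)
    rw [← Multiset.singleton_add, ← Multiset.singleton_add]
    refine TensorLE.add ?_ (hN n (le_trans (le_max_left _ _) hn))
    exact TensorLE.mono (hk.trans (hym (by omega))) (hl.trans (hzm (by omega)))

variable (S T) in
/-- The tensor product `S ⊗ T` of `Cu`-semigroups: countably generated round ideals of formal
sums with respect to the auxiliary relation `≺`. -/
@[ext]
structure CuTensor where
  carrier : Set (Multiset (S × T))
  zero_mem : 0 ∈ carrier
  lower : ∀ f g, TensorLE f g → g ∈ carrier → f ∈ carrier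
  round : ∀ f g, f ∈ carrier → g ∈ carrier → ∃ h ∈ carrier, TensorPrec f h ∧ TensorPrec g h
  countable : ∃ c : ℕ → Multiset (S × T), (∀ n, c n ∈ carrier) ∧
    ∀ f ∈ carrier, ∃ n, TensorLE f (c n)

namespace CuTensor

/-- The ideal of all `f ≺ g`: the image of a formal sum in the tensor product. -/
def principal (g : Multiset (S × T)) : CuTensor S T where
  carrier := {f | TensorPrec f g}
  zero_mem := by
    obtain ⟨c, -, h₂, -⟩ := exists_rel_seq g
    exact tensorPrec_iff.mpr ⟨c 0, .zero_le _, h₂ 0⟩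
  lower f g' h hg := TensorPrec.of_le_left h hg
  round := by
    intro f₁ f₂ h₁ h₂
    obtain ⟨c, hc, hcg, hcf⟩ := exists_rel_seq g
    obtain ⟨f₁', h₁, h₁'⟩ := tensorPrec_iff.mp h₁
    obtain ⟨f₂', h₂, h₂'⟩ := tensorPrec_iff.mp h₂
    obtain ⟨N, hN⟩ := hcf _ h₁'
    obtain ⟨M, hM⟩ := hcf _ h₂'
    refine ⟨c (max N M + 1), tensorPrec_iff.mpr ⟨_, .refl _, hcg _⟩, ?_, ?_⟩
    · exact tensorPrec_iff.mpr ⟨_, h₁.trans (hN _ (le_max_left _ _)), hc _⟩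
    · exact tensorPrec_iff.mpr ⟨_, h₂.trans (hM _ (le_max_right _ _)), hc _⟩
  countable := by
    obtain ⟨c, hc, hcg, hcf⟩ := exists_rel_seq g
    refine ⟨c, fun n => tensorPrec_iff.mpr ⟨_, .refl _, hcg _⟩, fun f hf => ?_⟩
    obtain ⟨f', h, h'⟩ := tensorPrec_iff.mp hf
    obtain ⟨N, hN⟩ := hcf _ h'
    exact ⟨N, h.trans (hN N le_rfl)⟩

/-- The elementary tensor `x ⊗ y`. -/
def tmul (x : S) (y : T) : CuTensor S T := principal {(x, y)}

instance : PartialOrder (CuTensor S T) :=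
  PartialOrder.lift carrier fun _ _ h => CuTensor.ext h

theorem le_def {I J : CuTensor S T} : I ≤ J ↔ I.carrier ⊆ J.carrier := Iff.rfl

instance : Zero (CuTensor S T) := ⟨principal 0⟩

/-- The sum of two ideals is the ideal generated by the sums of their elements. -/
instance : Add (CuTensor S T) where
  add I J :=
    { carrier := {h | ∃ f ∈ I.carrier, ∃ g ∈ J.carrier, TensorLE h (f + g)}
      zero_mem := ⟨0, I.zero_mem, 0, J.zero_mem, .zero_le _⟩
      lower := fun f g h ⟨a, ha, b, hb, hab⟩ => ⟨a, ha, b, hb, h.trans hab⟩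
      round := by
        rintro f f' ⟨a, ha, b, hb, hab⟩ ⟨a', ha', b', hb', hab'⟩
        obtain ⟨c, hc, h₁, h₂⟩ := I.round a a' ha ha'
        obtain ⟨d, hd, h₃, h₄⟩ := J.round b b' hb hb'
        exact ⟨c + d, ⟨c, hc, d, hd, .refl _⟩, .of_le_left hab (h₁.add h₃),
          .of_le_left hab' (h₂.add h₄)⟩
      countable := by
        obtain ⟨c, hc, hc'⟩ := I.countable
        obtain ⟨d, hd, hd'⟩ := J.countable
        refine ⟨fun n => c n.unpair.1 + d n.unpair.2,
          fun n => ⟨_, hc _, _, hd _, .refl _⟩, ?_⟩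
        rintro f ⟨a, ha, b, hb, hab⟩
        obtain ⟨n, hn⟩ := hc' a ha
        obtain ⟨m, hm⟩ := hd' b hb
        refine ⟨Nat.pair n m, ?_⟩
        simp only [Nat.unpair_pair]
        exact hab.trans (hn.add hm) }

theorem mem_add {I J : CuTensor S T} {h : Multiset (S × T)} :
    h ∈ (I + J).carrier ↔ ∃ f ∈ I.carrier, ∃ g ∈ J.carrier, TensorLE h (f + g) := Iff.rfl

theorem mem_zero {h : Multiset (S × T)} :
    h ∈ (0 : CuTensor S T).carrier ↔ TensorLE h 0 := by
  constructor
  · exact fun h' => TensorPrec.le h'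
  · exact fun h' => tensorPrec_iff.mpr ⟨0, h', .zero⟩

theorem add_comm' (I J : CuTensor S T) : I + J = J + I := by
  ext h
  simp only [mem_add]
  constructor <;> rintro ⟨f, hf, g, hg, hh⟩ <;> exact ⟨g, hg, f, hf, by rwa [add_comm]⟩

theorem zero_add' (I : CuTensor S T) : 0 + I = I := by
  ext h
  simp only [mem_add, mem_zero]
  constructor
  · rintro ⟨f, hf, g, hg, hh⟩
    refine I.lower _ _ (hh.trans (hf.add_right g)) ?_
    rwa [zero_add]
  · exact fun hh => ⟨0, .refl _, h, hh, by rw [zero_add]; exact .refl _⟩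

instance : AddCommMonoid (CuTensor S T) where
  add_assoc I J K := by
    ext h
    constructor
    · rintro ⟨f, ⟨a, ha, b, hb, hf⟩, g, hg, hh⟩
      refine ⟨a, ha, b + g, ⟨b, hb, g, hg, .refl _⟩, hh.trans ?_⟩
      rw [← add_assoc]
      exact hf.add_right g
    · rintro ⟨a, ha, g, ⟨b, hb, c, hc, hg⟩, hh⟩
      refine ⟨a + b, ⟨a, ha, b, hb, .refl _⟩, c, hc, hh.trans ?_⟩
      rw [add_assoc]
      exact (TensorLE.refl a).add hg
  zero_add := zero_add'
  add_zero I := by rw [add_comm', zero_add']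
  add_comm := add_comm'
  nsmul := nsmulRec

/-- The union of an increasing sequence of ideals. -/
def iUnion (I : ℕ → CuTensor S T) (hI : Monotone I) : CuTensor S T where
  carrier := ⋃ n, (I n).carrier
  zero_mem := Set.mem_iUnion.mpr ⟨0, (I 0).zero_mem⟩
  lower f g h hg := by
    obtain ⟨n, hn⟩ := Set.mem_iUnion.mp hg
    exact Set.mem_iUnion.mpr ⟨n, (I n).lower f g h hn⟩
  round f g hf hg := by
    obtain ⟨n, hn⟩ := Set.mem_iUnion.mp hf
    obtain ⟨m, hm⟩ := Set.mem_iUnion.mp hg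
    obtain ⟨h, hh, h'⟩ := (I (max n m)).round f g (hI (le_max_left _ _) hn)
      (hI (le_max_right _ _) hm)
    exact ⟨h, Set.mem_iUnion.mpr ⟨_, hh⟩, h'⟩
  countable := by
    choose c hc hc' using fun n => (I n).countable
    refine ⟨fun n => c n.unpair.1 n.unpair.2, fun n => Set.mem_iUnion.mpr ⟨_, hc _ _⟩, ?_⟩
    intro f hf
    obtain ⟨n, hn⟩ := Set.mem_iUnion.mp hf
    obtain ⟨m, hm⟩ := hc' n f hn
    exact ⟨Nat.pair n m, by simpa only [Nat.unpair_pair] using hm⟩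

theorem isLUB_iUnion (I : ℕ → CuTensor S T) (hI : Monotone I) :
    IsLUB (Set.range I) (iUnion I hI) := by
  constructor
  · rintro _ ⟨n, rfl⟩
    exact Set.subset_iUnion (fun n => (I n).carrier) n
  · intro J hJ
    exact Set.iUnion_subset fun n => hJ ⟨n, rfl⟩

theorem mem_of_isLUB {I : ℕ → CuTensor S T} (hI : Monotone I) {J : CuTensor S T}
    (hJ : IsLUB (Set.range I) J) {f : Multiset (S × T)} :
    f ∈ J.carrier ↔ ∃ n, f ∈ (I n).carrier := by
  rw [hJ.unique (isLUB_iUnion I hI)]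
  exact Set.mem_iUnion

theorem wayBelow_of_mem {I J : CuTensor S T} {g : Multiset (S × T)} (hg : g ∈ J.carrier)
    (h : ∀ f ∈ I.carrier, TensorLE f g) : WayBelow I J := by
  intro K hK s hs hJ
  obtain ⟨n, hn⟩ := (mem_of_isLUB hK hs).mp (hJ hg)
  exact ⟨n, fun f hf => (K n).lower _ _ (h f hf) hn⟩

/-- Every ideal is generated by a `≺`-increasing sequence. -/
theorem exists_prec_seq (I : CuTensor S T) : ∃ c : ℕ → Multiset (S × T),
    (∀ n, c n ∈ I.carrier) ∧ (∀ n, TensorPrec (c n) (c (n + 1))) ∧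
    ∀ f ∈ I.carrier, ∃ n, TensorPrec f (c n) := by
  obtain ⟨d, hd, hd'⟩ := I.countable
  choose! F hF hF₁ hF₂ using I.round
  let c : ℕ → Multiset (S × T) := fun n => Nat.rec 0 (fun k a => F a (d k)) n
  have hc : ∀ n, c n ∈ I.carrier := by
    intro n
    induction n with
    | zero => exact I.zero_mem
    | succ k ih => exact hF _ _ ih (hd k)
  refine ⟨c, hc, fun n => hF₁ _ _ (hc n) (hd n), fun f hf => ?_⟩
  obtain ⟨n, hn⟩ := hd' f hf
  exact ⟨n + 1, .of_le_left hn (hF₂ _ _ (hc n) (hd n))⟩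

theorem exists_principal_seq (I : CuTensor S T) : ∃ c : ℕ → Multiset (S × T),
    (∀ n, c n ∈ I.carrier) ∧ Monotone (fun n => principal (c n)) ∧
    (∀ n, WayBelow (principal (c n)) (principal (c (n + 1)))) ∧
    IsLUB (Set.range fun n => principal (c n)) I := by
  obtain ⟨c, hc, hc', hf⟩ := I.exists_prec_seq
  have hw : ∀ n, WayBelow (principal (c n)) (principal (c (n + 1))) := fun n =>
    wayBelow_of_mem (g := c n) (hc' n) fun f hf => TensorPrec.le hf
  refine ⟨c, hc, monotone_nat_of_le_succ fun n f (h : TensorPrec _ _) =>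
    TensorPrec.of_le_right h (hc' n).le, hw, ?_, ?_⟩
  · rintro _ ⟨n, rfl⟩ f hf
    exact I.lower _ _ (TensorPrec.le hf) (hc n)
  · intro J hJ f hfI
    obtain ⟨n, hn⟩ := hf f hfI
    exact hJ ⟨n, rfl⟩ hn

theorem wayBelow_iff {I J : CuTensor S T} :
    WayBelow I J ↔ ∃ g ∈ J.carrier, ∀ f ∈ I.carrier, TensorLE f g := by
  constructor
  · intro h
    obtain ⟨c, hc, hm, -, hl⟩ := J.exists_principal_seq
    obtain ⟨n, hn⟩ := h _ hm J hl le_rfl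
    exact ⟨c n, hc n, fun f hf => TensorPrec.le (hn hf)⟩
  · rintro ⟨g, hg, h⟩
    exact wayBelow_of_mem hg h

instance : CuSemigroup (CuTensor S T) where
  add_le_add_right' I J h K := by
    rintro f ⟨a, ha, b, hb, hab⟩
    exact ⟨a, h ha, b, hb, hab⟩
  zero_le' I := fun f hf => I.lower _ _ (mem_zero.mp hf) I.zero_mem
  O1 I hI := ⟨_, isLUB_iUnion I hI⟩
  O2 I := by
    obtain ⟨c, -, -, hw, hl⟩ := I.exists_principal_seq
    exact ⟨_, hw, hl⟩
  O3 I' I J' J hI hJ := by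
    obtain ⟨f, hf, hf'⟩ := wayBelow_iff.mp hI
    obtain ⟨g, hg, hg'⟩ := wayBelow_iff.mp hJ
    refine wayBelow_iff.mpr ⟨f + g, ⟨f, hf, g, hg, .refl _⟩, ?_⟩
    rintro h ⟨a, ha, b, hb, hab⟩
    exact hab.trans ((hf' a ha).add (hg' b hb))
  O4 I J hI hJ A B hA hB := by
    constructor
    · rintro _ ⟨n, rfl⟩ f ⟨a, ha, b, hb, hab⟩
      exact ⟨a, hA.1 ⟨n, rfl⟩ ha, b, hB.1 ⟨n, rfl⟩ hb, hab⟩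
    · rintro K hK f ⟨a, ha, b, hb, hab⟩
      obtain ⟨n, hn⟩ := (mem_of_isLUB hI hA).mp ha
      obtain ⟨m, hm⟩ := (mem_of_isLUB hJ hB).mp hb
      exact hK ⟨max n m, rfl⟩
        ⟨a, hI (le_max_left _ _) hn, b, hJ (le_max_right _ _) hm, hab⟩

end CuTensor

end Tensor

/-! # The Cuntz semigroup `K_q ⊔ (0, ∞]` of the UHF-algebra `M_q` -/

theorem Supernatural.IsDivisor.of_dvd {q : Supernatural} {m n : ℕ}
    (hn : Supernatural.IsDivisor n q) (h : m ∣ n) : Supernatural.IsDivisor m q := by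
  have hm : m ≠ 0 := by
    rintro rfl
    exact hn.1 (zero_dvd_iff.mp h)
  refine ⟨hm, fun p => le_trans ?_ (hn.2 p)⟩
  exact_mod_cast (Nat.factorization_le_iff_dvd hm hn.1).mpr h p

theorem Supernatural.IsDivisor.lcm {q : Supernatural} {m n : ℕ}
    (hm : Supernatural.IsDivisor m q) (hn : Supernatural.IsDivisor n q) :
    Supernatural.IsDivisor (m.lcm n) q := by
  refine ⟨Nat.lcm_ne_zero hm.1 hn.1, fun p => ?_⟩
  rw [Nat.factorization_lcm hm.1 hn.1, Finsupp.sup_apply]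
  rcases le_total (m.factorization p) (n.factorization p) with h | h
  · rw [sup_eq_right.mpr h]
    exact hn.2 p
  · rw [sup_eq_left.mpr h]
    exact hm.2 p

/-- `K_q`: the nonnegative rationals `k / n` with `k, n` coprime and `n` a divisor of `q`. -/
def UHFRational (q : Supernatural) : AddSubmonoid ℚ≥0 where
  carrier := {r | Supernatural.IsDivisor r.den q}
  zero_mem' := ⟨by simp, fun p => by simp⟩
  add_mem' {r s} hr hs := by
    refine (Supernatural.IsDivisor.lcm hr hs).of_dvd ?_
    have h := Rat.add_den_dvd_lcm (r : ℚ) (s : ℚ)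
    rw [← NNRat.coe_add] at h
    simpa only [NNRat.den_coe] using h

theorem UHFRational.one_mem (q : Supernatural) : (1 : ℚ≥0) ∈ UHFRational q :=
  ⟨by simp, fun p => by simp⟩

/-- The inclusion `K_q ⊆ [0, ∞]`. -/
noncomputable def uhfVal {q : Supernatural} (r : UHFRational q) : ℝ≥0∞ :=
  (((r : ℚ≥0) : ℝ≥0) : ℝ≥0∞)

/-- The disjoint union `K_q ⊔ (0, ∞]` of the compact and the nonzero soft elements of the Cuntz
semigroup of the UHF-algebra `M_q`. -/
inductive CuUHF (q : Supernatural) : Type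
  | compact (r : UHFRational q) : CuUHF q
  | soft (t : {t : ℝ≥0∞ // 0 < t}) : CuUHF q

namespace CuUHF

variable {q : Supernatural}

/-- The order is the usual one on `K_q` and on `(0, ∞]`; a soft element is below a compact one
when its value is `≤`, and a compact element is below a soft one when its value is `<`. -/
protected def le : CuUHF q → CuUHF q → Prop
  | compact r, compact s => r ≤ s
  | soft t, soft u => t ≤ u
  | soft t, compact r => (t : ℝ≥0∞) ≤ uhfVal r
  | compact r, soft t => uhfVal r < (t : ℝ≥0∞)

/-- Addition is the usual one on `K_q` and on `(0, ∞]`; the sum of a compact and a soft element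
is soft. -/
protected noncomputable def add : CuUHF q → CuUHF q → CuUHF q
  | compact r, compact s => compact (r + s)
  | soft t, soft u => soft ⟨t + u, lt_of_lt_of_le t.2 le_self_add⟩
  | soft t, compact r => soft ⟨t + uhfVal r, lt_of_lt_of_le t.2 le_self_add⟩
  | compact r, soft t => soft ⟨uhfVal r + t, lt_of_lt_of_le t.2 le_add_self⟩

instance : LE (CuUHF q) := ⟨CuUHF.le⟩
noncomputable instance : Add (CuUHF q) := ⟨CuUHF.add⟩
noncomputable instance : Zero (CuUHF q) := ⟨compact 0⟩

/-- The class of the unit of `M_q`. -/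
noncomputable instance : One (CuUHF q) := ⟨compact ⟨1, UHFRational.one_mem q⟩⟩

/-- The underlying value in `[0, ∞]`. -/
noncomputable def val : CuUHF q → ℝ≥0∞
  | compact r => uhfVal r
  | soft t => t

theorem uhfVal_le {r s : UHFRational q} : uhfVal r ≤ uhfVal s ↔ r ≤ s := by
  unfold uhfVal
  rw [ENNReal.coe_le_coe, NNRat.cast_le]
  rfl

theorem uhfVal_lt {r s : UHFRational q} : uhfVal r < uhfVal s ↔ r < s := by
  rw [← not_le, uhfVal_le, not_le]

theorem uhfVal_add (r s : UHFRational q) :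
    uhfVal (r + s) = uhfVal r + uhfVal s := by
  unfold uhfVal
  push_cast
  rfl

theorem uhfVal_zero : uhfVal (0 : UHFRational q) = 0 := by
  simp [uhfVal]

theorem uhfVal_ne_top (r : UHFRational q) : uhfVal r ≠ ⊤ := ENNReal.coe_ne_top

theorem soft_le {t : {t : ℝ≥0∞ // 0 < t}} {w : CuUHF q} : soft t ≤ w ↔ (t : ℝ≥0∞) ≤ val w := by
  cases w <;> exact Iff.rfl

theorem le_compact {r : UHFRational q} {w : CuUHF q} :
    w ≤ compact r ↔ val w ≤ uhfVal r := by
  cases w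
  · exact uhfVal_le.symm
  · exact Iff.rfl

theorem compact_le_soft {r : UHFRational q} {t : {t : ℝ≥0∞ // 0 < t}} :
    compact r ≤ soft t ↔ uhfVal r < t := Iff.rfl

theorem le_iff {x y : CuUHF q} : x ≤ y ↔
    val x < val y ∨ (val x = val y ∧ ((∃ r, x = compact r) → ∃ r, y = compact r)) := by
  rcases x with r | t <;> rcases y with s | u
  · rw [le_compact, le_iff_lt_or_eq]
    simp [val]
  · rw [compact_le_soft]
    simp [val]
  · rw [soft_le, le_iff_lt_or_eq]
    simp [val]
  · rw [soft_le, le_iff_lt_or_eq]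
    simp [val]

theorem val_le {x y : CuUHF q} (h : x ≤ y) : val x ≤ val y := by
  rcases le_iff.mp h with h | h
  exacts [h.le, h.1.le]

instance : PartialOrder (CuUHF q) where
  le_refl x := le_iff.mpr (Or.inr ⟨rfl, id⟩)
  le_trans x y z h h' := by
    rw [le_iff] at *
    rcases h with h | h <;> rcases h' with h' | h'
    · exact Or.inl (h.trans h')
    · exact Or.inl (h'.1 ▸ h)
    · exact Or.inl (h.1 ▸ h')
    · exact Or.inr ⟨h.1.trans h'.1, h'.2 ∘ h.2⟩
  le_antisymm x y h h' := by
    rcases x with r | t <;> rcases y with s | u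
    · exact congrArg compact (le_antisymm h h')
    · exact absurd (soft_le.mp h') (not_le.mpr h)
    · exact absurd (soft_le.mp h) (not_le.mpr h')
    · exact congrArg soft (le_antisymm h h')

theorem le_total (x y : CuUHF q) : x ≤ y ∨ y ≤ x := by
  rw [le_iff, le_iff]
  rcases lt_trichotomy (val x) (val y) with h | h | h
  · exact Or.inl (Or.inl h)
  · by_cases hx : ∃ r, x = compact r
    · exact Or.inr (Or.inr ⟨h.symm, fun _ => hx⟩)
    · exact Or.inl (Or.inr ⟨h, fun h' => absurd h' hx⟩)
  · exact Or.inr (Or.inl h)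

theorem zero_le (x : CuUHF q) : 0 ≤ x := by
  rcases x with r | t
  · exact (bot_le : (0 : ℚ≥0) ≤ r)
  · change uhfVal 0 < _
    rw [uhfVal_zero]
    exact t.2

theorem val_add (x y : CuUHF q) : val (x + y) = val x + val y := by
  rcases x with r | t <;> rcases y with s | u
  · exact uhfVal_add r s
  all_goals rfl

theorem ext_soft {t u : {t : ℝ≥0∞ // 0 < t}} (h : (t : ℝ≥0∞) = u) :
    (soft t : CuUHF q) = soft u := congrArg soft (Subtype.ext h)

theorem add_comm' (x y : CuUHF q) : x + y = y + x := by
  rcases x with r | t <;> rcases y with s | u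
  · exact congrArg compact (add_comm r s)
  all_goals exact ext_soft (add_comm _ _)

theorem zero_add' (x : CuUHF q) : 0 + x = x := by
  rcases x with r | t
  · exact congrArg compact (zero_add r)
  · refine ext_soft ?_
    change uhfVal 0 + _ = _
    rw [uhfVal_zero, zero_add]

noncomputable instance : AddCommMonoid (CuUHF q) where
  add_assoc x y z := by
    have h : val (x + y + z) = val (x + (y + z)) := by
      simp only [val_add, add_assoc]
    rcases x with r | t <;> rcases y with s | u <;> rcases z with v | v
    · exact congrArg compact (add_assoc r s v)
    all_goals exact ext_soft h
  zero_add := zero_add'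
  add_zero x := by rw [add_comm', zero_add']
  add_comm := add_comm'
  nsmul := nsmulRec

theorem add_le_add_right' (x y : CuUHF q) (h : x ≤ y) (z : CuUHF q) : x + z ≤ y + z := by
  rcases x with r | t <;> rcases z with s | u
  · rcases y with r' | t'
    · exact add_le_add_left (α := ℚ≥0) h s
    · change uhfVal (r + s) < (t' : ℝ≥0∞) + uhfVal s
      rw [uhfVal_add]
      exact ENNReal.add_lt_add_right (uhfVal_ne_top s) h
  all_goals
    refine soft_le.mpr ?_
    rw [val_add]
    exact add_le_add_left (val_le h) _

/-- Every sequence has a supremum, which has the expected value. -/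
theorem exists_isLUB (z : ℕ → CuUHF q) :
    ∃ s, IsLUB (Set.range z) s ∧ val s = ⨆ n, val (z n) := by
  by_cases h : ∃ n, ∀ m, z m ≤ z n
  · obtain ⟨n, hn⟩ := h
    refine ⟨z n, ⟨?_, fun w hw => hw ⟨n, rfl⟩⟩, le_antisymm (le_iSup (fun n => val (z n)) n)
      (iSup_le fun m => val_le (hn m))⟩
    rintro _ ⟨m, rfl⟩
    exact hn m
  · push Not at h
    have hpos : 0 < ⨆ n, val (z n) := by
      obtain ⟨m, hm⟩ := h 0
      refine lt_of_lt_of_le ?_ (le_iSup (fun n => val (z n)) m)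
      rw [pos_iff_ne_zero]
      intro h0
      refine hm (le_trans ?_ (zero_le _))
      refine le_compact.mpr ?_
      rw [h0]
      exact bot_le
    refine ⟨soft ⟨_, hpos⟩, ⟨?_, fun w hw => ?_⟩, rfl⟩
    · rintro _ ⟨n, rfl⟩
      have hle := le_iSup (fun n => val (z n)) n
      obtain ⟨m, hm⟩ := h n
      have hle' := le_iSup (fun n => val (z n)) m
      rcases hzn : z n with r | t
      · rw [hzn, le_compact, not_le] at hm
        exact lt_of_lt_of_le hm hle'
      · simp only [hzn] at hle
        exact soft_le.mpr hle
    · exact soft_le.mpr (iSup_le fun n => val_le (hw ⟨n, rfl⟩))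

theorem val_of_isLUB {z : ℕ → CuUHF q} {s : CuUHF q}
    (h : IsLUB (Set.range z) s) : val s = ⨆ n, val (z n) := by
  obtain ⟨s', h', hv⟩ := exists_isLUB z
  rw [h.unique h', hv]

theorem wayBelow_compact {x : CuUHF q} {r : UHFRational q} (h : x ≤ compact r) :
    WayBelow x (compact r) := by
  intro z hz s hs hle
  by_contra! hc
  have hc' : ∀ n, val (z n) ≤ uhfVal r ∧ ¬ compact r ≤ z n := fun n => by
    have h1 : ¬ compact r ≤ z n := fun h' => hc n (h.trans h')
    exact ⟨le_compact.mp ((le_total _ _).resolve_left h1), h1⟩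
  rcases eq_or_ne (uhfVal r) 0 with h0 | h0
  · refine (hc' 0).2 (le_trans (le_compact.mpr ?_) (zero_le _))
    exact h0.le.trans bot_le
  · have hs' : s ≤ soft ⟨uhfVal r, pos_iff_ne_zero.mpr h0⟩ := by
      refine hs.2 ?_
      rintro _ ⟨n, rfl⟩
      have hn := hc' n
      rcases hzn : z n with r' | t
      · rw [hzn, le_compact, not_le] at hn
        exact hn.2
      · rw [hzn] at hn
        exact soft_le.mpr hn.1
    exact lt_irrefl _ (compact_le_soft.mp (hle.trans hs'))

theorem wayBelow_of_val_lt {x y : CuUHF q} (h : val x < val y) : WayBelow x y := by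
  intro z hz s hs hle
  by_contra! hc
  have : s ≤ x := hs.2 (by
    rintro _ ⟨n, rfl⟩
    exact (le_total _ _).resolve_left (hc n))
  exact not_le.mpr h (val_le (hle.trans this))

theorem exists_soft_seq (t : {t : ℝ≥0∞ // 0 < t}) : ∃ z : ℕ → CuUHF q, StrictMono (val ∘ z) ∧
    Monotone z ∧ (∀ n, val (z n) < t) ∧ IsLUB (Set.range z) (soft t) := by
  obtain ⟨u, hu, hmem, hlim⟩ := exists_seq_strictMono_tendsto' t.2
  have hmono : Monotone fun n => (soft ⟨u n, (hmem n).1⟩ : CuUHF q) :=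
    fun n m h => soft_le.mpr (hu.monotone h)
  refine ⟨fun n => soft ⟨u n, (hmem n).1⟩, hu, hmono, fun n => (hmem n).2, ?_, ?_⟩
  · rintro _ ⟨n, rfl⟩
    exact soft_le.mpr (hmem n).2.le
  · intro w hw
    exact soft_le.mpr (le_of_tendsto' hlim fun n => soft_le.mp (hw ⟨n, rfl⟩))

theorem wayBelow_soft {x : CuUHF q} {t : {t : ℝ≥0∞ // 0 < t}} :
    WayBelow x (soft t) ↔ val x < t := by
  constructor
  · intro h
    obtain ⟨z, -, hm, hlt, hl⟩ := exists_soft_seq (q := q) t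
    obtain ⟨n, hn⟩ := h z hm _ hl le_rfl
    exact (val_le hn).trans_lt (hlt n)
  · exact fun h => wayBelow_of_val_lt h

theorem wayBelow_le {x y : CuUHF q} (h : WayBelow x y) : x ≤ y := by
  obtain ⟨n, hn⟩ := h (fun _ => y) monotone_const y (by simp) le_rfl
  exact hn

noncomputable instance : CuSemigroup (CuUHF q) where
  add_le_add_right' := add_le_add_right'
  zero_le' := zero_le
  O1 z _ := let ⟨s, hs, _⟩ := exists_isLUB z; ⟨s, hs⟩
  O2 a := by
    rcases a with r | t
    · exact ⟨fun _ => compact r, fun _ => wayBelow_compact le_rfl, by simp⟩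
    · obtain ⟨z, hs, -, -, hl⟩ := exists_soft_seq (q := q) t
      exact ⟨z, fun n => wayBelow_of_val_lt (hs n.lt_succ_self), hl⟩
  O3 a' a b' b ha hb := by
    have ha' := val_le (wayBelow_le ha)
    have hb' := val_le (wayBelow_le hb)
    rcases a with r | t <;> rcases b with s | u
    · refine wayBelow_compact (le_compact.mpr ?_)
      rw [val_add, uhfVal_add]
      exact add_le_add ha' hb'
    all_goals
      refine wayBelow_of_val_lt ?_
      rw [val_add, val_add]
    · exact ENNReal.add_lt_add_of_le_of_lt
        (ne_top_of_le_ne_top (uhfVal_ne_top r) ha') ha' (wayBelow_soft.mp hb)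
    · exact ENNReal.add_lt_add_of_lt_of_le
        (ne_top_of_le_ne_top (uhfVal_ne_top s) hb') (wayBelow_soft.mp ha) hb'
    · exact ENNReal.add_lt_add (wayBelow_soft.mp ha) (wayBelow_soft.mp hb)
  O4 y z hy hz a b ha hb := by
    have hadd : ∀ {x x' w w' : CuUHF q}, x ≤ x' → w ≤ w' → x + w ≤ x' + w' := by
      intro x x' w w' h h'
      refine (add_le_add_right' x x' h w).trans ?_
      rw [add_comm' x', add_comm' x']
      exact add_le_add_right' w w' h' x'
    constructor
    · rintro _ ⟨n, rfl⟩
      exact hadd (ha.1 ⟨n, rfl⟩) (hb.1 ⟨n, rfl⟩)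
    · intro w hw
      have hv : val a + val b ≤ val w := by
        rw [val_of_isLUB ha, val_of_isLUB hb, ENNReal.iSup_add_iSup_of_monotone
          (fun n m h => val_le (hy h)) (fun n m h => val_le (hz h))]
        refine iSup_le fun n => ?_
        rw [← val_add]
        exact val_le (hw ⟨n, rfl⟩)
      rcases a with r | t <;> rcases b with s | u
      · obtain ⟨n, hn⟩ := wayBelow_compact (le_refl (compact r)) y hy _ ha le_rfl
        obtain ⟨m, hm⟩ := wayBelow_compact (le_refl (compact s)) z hz _ hb le_rfl
        exact le_trans (hadd (hn.trans (hy (le_max_left n m))) (hm.trans (hz (le_max_right n m))))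
          (hw ⟨max n m, rfl⟩)
      all_goals exact soft_le.mpr hv

end CuUHF

/-! The map `γ` comes from a bimorphism on `S₁ × Cu(M_q)`, built first on `K_q` and then extended by
suprema.

For `r = k / n` in `K_q`, divisibility gives `y` with `φ₁ x = n • y`, and `(x, r)` is sent to `φ₂ (k
• y)`. The element `y` is not unique, but its image is. If `n • y ≤ n' • y'` and `k / n ≤ k' / n'`,
then `(n * n') • k • y ≤ (n * n') • k' • y'`; since `q = q²`, the product `n * n'` divides `q`, and
unperforation gives `φ₂ (k • y) ≤ φ₂ (k' • y')`. This comparison (`IsQUnperforated.map_nsmul_le`)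
yields independence of choices (`rationalMul_eq`) and from there the algebraic properties
(`isRationalBimorphism_rationalMul`). Suprema in `x` need an approximation argument
(`isLUB_of_nsmul`), because the chosen quotients `y` need not form increasing sequences in `S₂`.

A soft element of `Cu(M_q)` is reached from the compact elements below it. Since `q ≠ 1`, some prime
has infinite exponent, so `K_q` is dense and a compact element fits between any `x ≪ y`
(`CuUHF.exists_compact_between`). This makes the extension by suprema additive; compactness of the
elements of `K_q` makes it continuous.

Finally, a bimorphism factors through the tensor product by taking the supremum of its values on the
formal sums in an ideal (`CuTensor.isGenCuMorphism_lift`). Preservation of `≪` passes through each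
stage. -/

/-! # Suprema of countably directed sets -/

section Cofinal

variable {T : Type w}

/-- The set `D` contains an increasing sequence that is cofinal in `D`. -/
def HasCofinalSeq [Preorder T] (D : Set T) : Prop :=
  ∃ z : ℕ → T, Monotone z ∧ (∀ n, z n ∈ D) ∧ ∀ d ∈ D, ∃ n, d ≤ z n

theorem isLUB_iff_of_cofinal [Preorder T] {D : Set T} {z : ℕ → T} (h : ∀ n, z n ∈ D)
    (h' : ∀ d ∈ D, ∃ n, d ≤ z n) {s : T} : IsLUB (Set.range z) s ↔ IsLUB D s := by
  refine isLUB_congr (Set.Subset.antisymm ?_ ?_)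
  · intro b hb d hd
    obtain ⟨n, hn⟩ := h' d hd
    exact hn.trans (hb ⟨n, rfl⟩)
  · rintro b hb _ ⟨n, rfl⟩
    exact hb (h n)

/-- (O1) provides suprema of increasing sequences only, so every supremum below is taken over a set
with a cofinal one. -/
theorem HasCofinalSeq.exists_isLUB [CuSemigroup T] {D : Set T} (hD : HasCofinalSeq D) :
    ∃ s, IsLUB D s := by
  obtain ⟨z, hz, hm, hc⟩ := hD
  obtain ⟨s, hs⟩ := CuSemigroup.O1 z hz
  exact ⟨s, (isLUB_iff_of_cofinal hm hc).mp hs⟩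

/-- If the sums of elements of `D` and `E` lie in `F` and are cofinal in `F`, then the supremum
of `F` is the sum of the suprema of `D` and `E`. -/
theorem HasCofinalSeq.isLUB_add [CuSemigroup T] {D E F : Set T} (hD : HasCofinalSeq D)
    (hE : HasCofinalSeq E) {a b : T} (ha : IsLUB D a) (hb : IsLUB E b)
    (hF : ∀ d ∈ D, ∀ e ∈ E, d + e ∈ F) (hF' : ∀ f ∈ F, ∃ d ∈ D, ∃ e ∈ E, f ≤ d + e) :
    IsLUB F (a + b) := by
  obtain ⟨y, hy, hyD, hyc⟩ := hD
  obtain ⟨z, hz, hzE, hzc⟩ := hE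
  refine (isLUB_iff_of_cofinal (fun n => hF _ (hyD n) _ (hzE n)) fun f hf => ?_).mp
    (CuSemigroup.O4 y z hy hz a b ((isLUB_iff_of_cofinal hyD hyc).mpr ha)
      ((isLUB_iff_of_cofinal hzE hzc).mpr hb))
  obtain ⟨d, hd, e, he, hde⟩ := hF' f hf
  obtain ⟨n, hn⟩ := hyc d hd
  obtain ⟨m, hm⟩ := hzc e he
  exact ⟨max n m, hde.trans (add_le_add (hn.trans (hy (le_max_left _ _)))
    (hm.trans (hz (le_max_right _ _))))⟩

/-- A nonempty subset of a countable total preorder is directed and countable; running through an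
enumeration and passing to upper bounds gives the sequence. The index set will be `K_q`. -/
theorem HasCofinalSeq.image_of_total {ι : Type*} [Countable ι] [Preorder ι] [Preorder T]
    (htot : ∀ i j : ι, i ≤ j ∨ j ≤ i) {A : Set ι} (hA : A.Nonempty) {f : ι → T}
    (hf : Monotone f) : HasCofinalSeq (f '' A) := by
  have := hA.to_subtype
  have := Encodable.ofCountable A
  have := Classical.inhabited_of_nonempty hA.to_subtype
  have hdir : Directed (· ≤ ·) fun i : A => f i := fun i j => by
    rcases htot i j with h | h
    exacts [⟨j, hf h, le_rfl⟩, ⟨i, le_rfl, hf h⟩]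
  refine ⟨_, hdir.sequence_mono, fun n => ⟨_, (hdir.sequence _ n).2, rfl⟩, ?_⟩
  rintro _ ⟨i, hi, rfl⟩
  exact ⟨_, hdir.rel_sequence ⟨i, hi⟩⟩

end Cofinal

/-! ### Natural multiples -/

theorem WayBelow.nsmul {S : Type u} [CuSemigroup S] {x y : S} (h : WayBelow x y) (n : ℕ) :
    WayBelow (n • x) (n • y) := by
  induction n with
  | zero => simpa only [zero_smul] using WayBelow.zero (0 : S)
  | succ k ih => simpa only [succ_nsmul] using CuSemigroup.O3 _ _ _ _ ih h

theorem IsGenCuMorphism.map_nsmul {S : Type u} {T : Type v} [CuSemigroup S] [CuSemigroup T]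
    {f : S → T} (hf : IsGenCuMorphism f) (n : ℕ) (x : S) : f (n • x) = n • f x := by
  induction n with
  | zero => simpa only [zero_smul] using hf.map_zero
  | succ k ih => rw [succ_nsmul, succ_nsmul, hf.map_add, ih]

/-! # The universal property of the tensor product -/

/-- The value of `β` on a formal sum. -/
def formalSumEval {S : Type u} {T : Type v} {U : Type w} [AddCommMonoid U]
    (β : S → T → U) (f : Multiset (S × T)) : U := (f.map fun p => β p.1 p.2).sum

theorem formalSumEval_add {S : Type u} {T : Type v} {U : Type w} [AddCommMonoid U]
    (β : S → T → U) (f g : Multiset (S × T)) :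
    formalSumEval β (f + g) = formalSumEval β f + formalSumEval β g := by
  simp [formalSumEval]

theorem formalSumEval_singleton {S : Type u} {T : Type v} {U : Type w} [AddCommMonoid U]
    (β : S → T → U) (x : S) (y : T) :
    formalSumEval β {(x, y)} = β x y := by
  simp [formalSumEval]

theorem formalSumEval_zero {S : Type u} {T : Type v} {U : Type w} [AddCommMonoid U]
    (β : S → T → U) : formalSumEval β 0 = 0 := by
  simp [formalSumEval]

section Universal

variable {S : Type u} {T : Type v} {U : Type w} [CuSemigroup S] [CuSemigroup T] [CuSemigroup U]

/-- A generalized `Cu`-bimorphism: a generalized `Cu`-morphism in each variable. -/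
structure IsGenCuBimorphism (β : S → T → U) : Prop where
  left : ∀ y, IsGenCuMorphism fun x => β x y
  right : ∀ x, IsGenCuMorphism (β x)

namespace IsGenCuBimorphism

variable {β : S → T → U}

theorem mono (hβ : IsGenCuBimorphism β) {x x' : S} {y y' : T} (hx : x ≤ x') (hy : y ≤ y') :
    β x y ≤ β x' y' :=
  ((hβ.left y).monotone hx).trans ((hβ.right x').monotone hy)

/-- Separate continuity gives an iterated supremum over pairs `(n, m)`; by monotonicity the diagonal
is cofinal among these pairs. -/
theorem isLUB (hβ : IsGenCuBimorphism β) {x : ℕ → S} {y : ℕ → T} (hx : Monotone x)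
    (hy : Monotone y) {a : S} {b : T} (ha : IsLUB (Set.range x) a) (hb : IsLUB (Set.range y) b) :
    IsLUB (Set.range fun n => β (x n) (y n)) (β a b) := by
  constructor
  · rintro _ ⟨n, rfl⟩
    exact hβ.mono (ha.1 ⟨n, rfl⟩) (hb.1 ⟨n, rfl⟩)
  · intro c hc
    refine ((hβ.left b).map_sup x hx a ha).2 ?_
    rintro _ ⟨n, rfl⟩
    refine ((hβ.right (x n)).map_sup y hy b hb).2 ?_
    rintro _ ⟨m, rfl⟩
    exact (hβ.mono (hx (le_max_left n m)) (hy (le_max_right n m))).trans (hc ⟨max n m, rfl⟩)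

end IsGenCuBimorphism

/-- Each generating relation of the preorder is an instance of monotonicity or biadditivity of `β`.
-/
theorem TensorLE.formalSumEval_le {β : S → T → U} (hβ : IsGenCuBimorphism β)
    {f g : Multiset (S × T)} (h : TensorLE f g) : formalSumEval β f ≤ formalSumEval β g := by
  induction h with
  | refl f => exact le_rfl
  | trans _ _ h₁ h₂ => exact h₁.trans h₂
  | add_right h _ ih =>
    rw [formalSumEval_add, formalSumEval_add]
    exact CuSemigroup.add_le_add_right' _ _ ih _
  | mono hx hy => simpa only [formalSumEval_singleton] using hβ.mono hx hy
  | add_fst_le x x' y =>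
    simpa only [formalSumEval_add, formalSumEval_singleton] using ((hβ.left y).map_add x x').le
  | le_add_fst x x' y =>
    simpa only [formalSumEval_add, formalSumEval_singleton] using ((hβ.left y).map_add x x').ge
  | add_snd_le x y y' =>
    simpa only [formalSumEval_add, formalSumEval_singleton] using ((hβ.right x).map_add y y').le
  | le_add_snd x y y' =>
    simpa only [formalSumEval_add, formalSumEval_singleton] using ((hβ.right x).map_add y y').ge
  | zero_fst_le y =>
    simpa only [formalSumEval_zero, formalSumEval_singleton] using (hβ.left y).map_zero.le
  | le_zero_fst y =>
    simpa only [formalSumEval_zero, formalSumEval_singleton] using (hβ.left y).map_zero.ge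
  | zero_snd_le x =>
    simpa only [formalSumEval_zero, formalSumEval_singleton] using (hβ.right x).map_zero.le
  | le_zero_snd x =>
    simpa only [formalSumEval_zero, formalSumEval_singleton] using (hβ.right x).map_zero.ge

namespace CuTensor

theorem hasCofinalSeq_image {β : S → T → U} (hβ : IsGenCuBimorphism β) (I : CuTensor S T) :
    HasCofinalSeq (formalSumEval β '' I.carrier) := by
  obtain ⟨c, hc, hc', hf⟩ := I.exists_prec_seq
  refine ⟨fun n => formalSumEval β (c n),
    monotone_nat_of_le_succ fun n => (hc' n).le.formalSumEval_le hβ, fun n => ⟨_, hc n, rfl⟩, ?_⟩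
  rintro _ ⟨f, hfI, rfl⟩
  obtain ⟨n, hn⟩ := hf f hfI
  exact ⟨n, hn.le.formalSumEval_le hβ⟩

/-- The map on the tensor product induced by a generalized `Cu`-bimorphism. -/
noncomputable def lift {β : S → T → U} (hβ : IsGenCuBimorphism β) (I : CuTensor S T) : U :=
  (hasCofinalSeq_image hβ I).exists_isLUB.choose

theorem isLUB_lift {β : S → T → U} (hβ : IsGenCuBimorphism β) (I : CuTensor S T) :
    IsLUB (formalSumEval β '' I.carrier) (lift hβ I) :=
  (hasCofinalSeq_image hβ I).exists_isLUB.choose_spec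

/-- The ideal of `x ⊗ y` contains `a n ⊙ b n` for `≪`-increasing sequences with suprema `x` and `y`,
and the values there already have supremum `β x y`. -/
theorem lift_tmul {β : S → T → U} (hβ : IsGenCuBimorphism β) (x : S) (y : T) :
    lift hβ (tmul x y) = β x y := by
  refine (isLUB_lift hβ _).unique ⟨?_, ?_⟩
  · rintro _ ⟨f, hf, rfl⟩
    exact (formalSumEval_singleton β x y) ▸ (TensorPrec.le hf).formalSumEval_le hβ
  · intro c hc
    obtain ⟨a, ha, -, hax, hal⟩ := CuSemigroup.exists_seq x
    obtain ⟨b, hb, -, hby, hbl⟩ := CuSemigroup.exists_seq y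
    refine (hβ.isLUB ha hb hal hbl).2 ?_
    rintro _ ⟨n, rfl⟩
    exact hc ⟨{(a n, b n)}, tensorPrec_iff.mpr ⟨_, .refl _, rel_pair (hax n) (hby n)⟩,
      formalSumEval_singleton β _ _⟩

/-- Sums of ideals are generated by sums of their elements, and suprema of increasing sequences are
unions, so both are visible on the sets of values. -/
theorem isGenCuMorphism_lift {β : S → T → U} (hβ : IsGenCuBimorphism β) :
    IsGenCuMorphism (lift hβ) where
  map_zero := by
    refine (isLUB_lift hβ 0).unique ⟨?_, fun c _ => CuSemigroup.zero_le' c⟩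
    rintro _ ⟨f, hf, rfl⟩
    exact (formalSumEval_zero β) ▸ (mem_zero.mp hf).formalSumEval_le hβ
  map_add I J := by
    refine (isLUB_lift hβ (I + J)).unique ((hasCofinalSeq_image hβ I).isLUB_add
      (hasCofinalSeq_image hβ J) (isLUB_lift hβ I) (isLUB_lift hβ J) ?_ ?_)
    · rintro _ ⟨f, hf, rfl⟩ _ ⟨g, hg, rfl⟩
      exact ⟨f + g, ⟨f, hf, g, hg, .refl _⟩, formalSumEval_add β f g⟩
    · rintro _ ⟨h, ⟨f, hf, g, hg, hh⟩, rfl⟩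
      exact ⟨_, ⟨f, hf, rfl⟩, _, ⟨g, hg, rfl⟩,
        formalSumEval_add β f g ▸ hh.formalSumEval_le hβ⟩
  monotone I J h := (isLUB_lift hβ I).mono (isLUB_lift hβ J) (Set.image_mono h)
  map_sup I hI J hJ := by
    constructor
    · rintro _ ⟨n, rfl⟩
      exact (isLUB_lift hβ _).mono (isLUB_lift hβ J) (Set.image_mono (hJ.1 ⟨n, rfl⟩))
    · intro c hc
      refine (isLUB_lift hβ J).2 ?_
      rintro _ ⟨f, hf, rfl⟩
      obtain ⟨n, hn⟩ := (mem_of_isLUB hI hJ).mp hf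
      exact ((isLUB_lift hβ (I n)).1 ⟨f, hn, rfl⟩).trans (hc ⟨n, rfl⟩)

/-- A generalized `Cu`-bimorphism that jointly preserves `≪` induces a `Cu`-morphism. -/
theorem isCuMorphism_lift {β : S → T → U} (hβ : IsGenCuBimorphism β)
    (hw : ∀ x' x y' y, WayBelow x' x → WayBelow y' y → WayBelow (β x' y') (β x y)) :
    IsCuMorphism (lift hβ) where
  toIsGenCuMorphism := isGenCuMorphism_lift hβ
  map_wayBelow I J h := by
    have hrel : ∀ f g : Multiset (S × T), Multiset.Rel PairWayBelow f g →
        WayBelow (formalSumEval β f) (formalSumEval β g) := by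
      intro f g hfg
      induction hfg with
      | zero => exact formalSumEval_zero β ▸ WayBelow.zero _
      | cons hab _ ih =>
        simp only [formalSumEval, Multiset.map_cons, Multiset.sum_cons]
        exact CuSemigroup.O3 _ _ _ _ (hw _ _ _ _ hab.1 hab.2) ih
    obtain ⟨g, hg, hf⟩ := wayBelow_iff.mp h
    -- The bound `g` for `I` need not have value `≪ lift hβ J` by mere membership in `J`; roundness
    -- supplies `k ∈ J` with `g ≺ k`, hence `≪` between the values.
    obtain ⟨k, hk, hgk, -⟩ := J.round g g hg hg
    obtain ⟨g', hg', hk'⟩ := tensorPrec_iff.mp hgk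
    refine WayBelow.of_le_left ?_ ((hrel _ _ hk').of_le_right ((isLUB_lift hβ J).1 ⟨k, hk, rfl⟩))
    refine (isLUB_lift hβ I).2 ?_
    rintro _ ⟨f, hfI, rfl⟩
    exact ((hf f hfI).trans hg').formalSumEval_le hβ

end CuTensor

end Universal

/-! # Supernatural numbers with `q = q²` -/

namespace Supernatural

variable {q : Supernatural}

theorem exponent_eq_zero_or_top (hq : q = q ^ 2) (p : Nat.Primes) :
    q.exponent p = 0 ∨ q.exponent p = ⊤ := by
  have h : q.exponent p = q.exponent p + q.exponent p := by
    conv_lhs => rw [hq, pow_two]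
    rfl
  by_cases ht : q.exponent p = ⊤
  · exact Or.inr ht
  · obtain ⟨n, hn⟩ := ENat.ne_top_iff_exists.mp ht
    rw [← hn] at h ⊢
    norm_cast at h ⊢
    omega

/-- With exponents in `{0, ∞}`, a divisor is any nonzero number whose prime factors have exponent
`∞`, a condition stable under products. -/
theorem IsDivisor.mul (hq : q = q ^ 2) {m n : ℕ} (hm : IsDivisor m q) (hn : IsDivisor n q) :
    IsDivisor (m * n) q := by
  refine ⟨mul_ne_zero hm.1 hn.1, fun p => ?_⟩
  rcases exponent_eq_zero_or_top hq p with h | h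
  · have h₁ := hm.2 p
    have h₂ := hn.2 p
    rw [h] at h₁ h₂ ⊢
    rw [Nat.factorization_mul hm.1 hn.1, Finsupp.add_apply]
    norm_cast at h₁ h₂ ⊢
    omega
  · rw [h]
    exact le_top

theorem exists_prime_pow_isDivisor (hq : q = q ^ 2) (hq1 : q ≠ 1) :
    ∃ p : ℕ, p.Prime ∧ ∀ k, IsDivisor (p ^ k) q := by
  obtain ⟨p, hp⟩ : ∃ p, q.exponent p ≠ 0 := by
    by_contra! h
    exact hq1 (funext h)
  have hp' := (exponent_eq_zero_or_top hq p).resolve_left hp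
  refine ⟨p, p.2, fun k => ⟨pow_ne_zero _ p.2.ne_zero, fun l => ?_⟩⟩
  by_cases hl : p = l
  · rw [← hl, hp']
    exact le_top
  · rw [p.2.factorization_pow, Finsupp.single_eq_of_ne fun h => hl (Subtype.ext h.symm)]
    exact bot_le

end Supernatural

/-! # Compact elements of `Cu(M_q)` -/

namespace UHFRational

variable {q : Supernatural}

/-- The fraction need not be reduced: its reduced denominator divides `n`. -/
theorem div_mem {n : ℕ} (hn : Supernatural.IsDivisor n q) (k : ℕ) :
    (k / n : ℚ≥0) ∈ UHFRational q := by
  refine hn.of_dvd ?_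
  have h := Rat.den_dvd k n
  rw [Rat.divInt_eq_div, Int.cast_natCast, Int.cast_natCast] at h
  rw [← NNRat.den_coe, NNRat.coe_div, NNRat.coe_natCast, NNRat.coe_natCast]
  exact Int.natCast_dvd_natCast.mp h

/-- All powers of some prime `p` divide `q`, so fractions with denominator `p ^ k` are available at
arbitrarily fine scale. -/
theorem exists_between (hq : q = q ^ 2) (hq1 : q ≠ 1) {a b : ℝ≥0∞} (h : a < b) :
    ∃ r : UHFRational q, a ≤ uhfVal r ∧ uhfVal r < b := by
  obtain ⟨p, hp, hpow⟩ := Supernatural.exists_prime_pow_isDivisor hq hq1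
  -- As `b` may be `∞`, the gap is measured up to a finite `c`.
  obtain ⟨c, hac, hcb⟩ := ENNReal.lt_iff_exists_nnreal_btwn.mp h
  lift a to ℝ≥0 using ne_top_of_lt h
  rw [ENNReal.coe_lt_coe] at hac
  obtain ⟨k, hk⟩ := exists_pow_lt_of_lt_one (tsub_pos_of_lt hac)
    (inv_lt_one_of_one_lt₀ (by exact_mod_cast hp.one_lt : (1 : ℝ≥0) < p))
  have hpk : (0 : ℝ≥0) < (p : ℝ≥0) ^ k := pow_pos (by exact_mod_cast hp.pos) k
  -- Rounding `a` up to a multiple of `1 / p ^ k` adds less than `1 / p ^ k < c - a`.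
  refine ⟨⟨_, div_mem (hpow k) ⌈a * p ^ k⌉₊⟩, ?_, lt_trans ?_ hcb⟩
  · rw [uhfVal, ENNReal.coe_le_coe]
    push_cast
    rw [le_div_iff₀ hpk]
    exact Nat.le_ceil _
  · rw [uhfVal, ENNReal.coe_lt_coe]
    push_cast
    rw [div_lt_iff₀ hpk]
    refine (Nat.ceil_lt_add_one bot_le).trans_le ?_
    rw [inv_pow] at hk
    have h₁ := (inv_lt_iff_one_lt_mul₀ hpk).mp hk
    calc a * p ^ k + 1 ≤ a * p ^ k + (c - a) * p ^ k := by
          exact add_le_add le_rfl (mul_comm (c - a) _ ▸ h₁.le)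
      _ = c * p ^ k := by rw [← add_mul, add_tsub_cancel_of_le hac.le]

end UHFRational

namespace CuUHF

variable {q : Supernatural}

/-- A compact `y` serves itself; below a soft `y`, density of `K_q` applies. The weak lower bound
suffices, since comparison with a compact element from below depends on values only. -/
theorem exists_compact_between (hq : q = q ^ 2) (hq1 : q ≠ 1) {x y : CuUHF q}
    (h : WayBelow x y) : ∃ r, x ≤ compact r ∧ compact r ≤ y := by
  rcases y with s | t
  · exact ⟨s, h.le, le_rfl⟩
  · obtain ⟨r, hr, hr'⟩ := UHFRational.exists_between hq hq1 (wayBelow_soft.mp h)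
    exact ⟨r, le_compact.mpr hr, hr'⟩

/-- A compact element is `≪` itself, so it lies below `x' + y'` with `x' ≪ x` and `y' ≪ y`; then
`x'` and `y'` are enlarged to compact elements. This is what makes the extension by suprema
additive. -/
theorem exists_compact_add (hq : q = q ^ 2) (hq1 : q ≠ 1) {t : UHFRational q} {x y : CuUHF q}
    (h : compact t ≤ x + y) : ∃ r s, compact r ≤ x ∧ compact s ≤ y ∧ t ≤ r + s := by
  obtain ⟨x', y', hx, hy, hle⟩ := ((wayBelow_compact le_rfl).of_le_right h).exists_add
  obtain ⟨r, hr, hr'⟩ := exists_compact_between hq hq1 hx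
  obtain ⟨s, hs, hs'⟩ := exists_compact_between hq hq1 hy
  exact ⟨r, s, hr', hs', (hle.trans (add_le_add hr hs) : compact t ≤ compact r + compact s)⟩

end CuUHF

/-! # Extension of bimorphisms from `K_q` to `Cu(M_q)` -/

section Extend

variable {q : Supernatural} {S : Type u} {T : Type v} [CuSemigroup S] [CuSemigroup T]

/-- A map that is a generalized `Cu`-morphism in the first variable and an order-preserving
monoid morphism in the second variable, which ranges over `K_q`. -/
structure IsRationalBimorphism (ψ : S → UHFRational q → T) : Prop where
  left : ∀ r, IsGenCuMorphism fun x => ψ x r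
  map_zero : ∀ x, ψ x 0 = 0
  map_add : ∀ x r s, ψ x (r + s) = ψ x r + ψ x s
  monotone : ∀ x, Monotone (ψ x)

/-- The values of `ψ x` at the compact elements below `y`. -/
def compactValues (ψ : S → UHFRational q → T) (x : S) (y : CuUHF q) : Set T :=
  ψ x '' {r | CuUHF.compact r ≤ y}

namespace IsRationalBimorphism

variable {ψ : S → UHFRational q → T}

theorem hasCofinalSeq (hψ : IsRationalBimorphism ψ) (x : S) (y : CuUHF q) :
    HasCofinalSeq (compactValues ψ x y) :=
  HasCofinalSeq.image_of_total le_total ⟨0, CuUHF.zero_le y⟩ (hψ.monotone x)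

/-- The extension of `ψ` to `Cu(M_q)` by suprema. -/
noncomputable def extend (hψ : IsRationalBimorphism ψ) (x : S) (y : CuUHF q) : T :=
  (hψ.hasCofinalSeq x y).exists_isLUB.choose

theorem isLUB_extend (hψ : IsRationalBimorphism ψ) (x : S) (y : CuUHF q) :
    IsLUB (compactValues ψ x y) (hψ.extend x y) :=
  (hψ.hasCofinalSeq x y).exists_isLUB.choose_spec

theorem le_extend (hψ : IsRationalBimorphism ψ) (x : S) {r : UHFRational q} {y : CuUHF q}
    (h : CuUHF.compact r ≤ y) : ψ x r ≤ hψ.extend x y :=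
  (hψ.isLUB_extend x y).1 ⟨r, h, rfl⟩

theorem extend_compact (hψ : IsRationalBimorphism ψ) (x : S) (r : UHFRational q) :
    hψ.extend x (CuUHF.compact r) = ψ x r := by
  refine (hψ.isLUB_extend x _).unique ⟨?_, fun c hc => hc ⟨r, le_refl (CuUHF.compact r), rfl⟩⟩
  rintro _ ⟨s, hs, rfl⟩
  exact hψ.monotone x hs

theorem extend_mono_left (hψ : IsRationalBimorphism ψ) (y : CuUHF q) :
    Monotone fun x => hψ.extend x y := by
  intro x x' h
  refine (hψ.isLUB_extend x y).2 ?_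
  rintro _ ⟨r, hr, rfl⟩
  exact ((hψ.left r).monotone h).trans (hψ.le_extend x' hr)

theorem isGenCuMorphism_extend_left (hψ : IsRationalBimorphism ψ) (y : CuUHF q) :
    IsGenCuMorphism fun x => hψ.extend x y where
  map_zero := by
    refine (hψ.isLUB_extend 0 y).unique ⟨?_, fun c _ => CuSemigroup.zero_le' c⟩
    rintro _ ⟨r, -, rfl⟩
    exact (hψ.left r).map_zero.le
  map_add a b := by
    -- The sequence is chosen in `K_q`, independently of the first variable, so that the suprema for
    -- `a`, `b` and `a + b` run over the same indices and (O4) applies.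
    obtain ⟨z, hz, hm, hc⟩ : ∃ z : ℕ → UHFRational q, Monotone z ∧
        (∀ n, z n ∈ {r | CuUHF.compact r ≤ y}) ∧
        ∀ d ∈ {r | CuUHF.compact r ≤ y}, ∃ n, d ≤ z n := by
      have h := HasCofinalSeq.image_of_total (f := id) (A := {r | CuUHF.compact r ≤ y})
        le_total ⟨0, CuUHF.zero_le y⟩ monotone_id
      rwa [Set.image_id] at h
    have hlub : ∀ x, IsLUB (Set.range fun n => ψ x (z n)) (hψ.extend x y) := fun x => by
      refine (isLUB_iff_of_cofinal (D := compactValues ψ x y) (fun n => ⟨z n, hm n, rfl⟩)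
        ?_).mpr (hψ.isLUB_extend x y)
      rintro _ ⟨r, hr, rfl⟩
      obtain ⟨n, hn⟩ := hc r hr
      exact ⟨n, hψ.monotone x hn⟩
    refine (hlub (a + b)).unique ?_
    simp only [(hψ.left _).map_add]
    exact CuSemigroup.O4 _ _ ((hψ.monotone a).comp hz) ((hψ.monotone b).comp hz) _ _
      (hlub a) (hlub b)
  monotone := hψ.extend_mono_left y
  map_sup z hz s hs := by
    constructor
    · rintro _ ⟨n, rfl⟩
      exact hψ.extend_mono_left y (hs.1 ⟨n, rfl⟩)
    · intro c hc
      refine (hψ.isLUB_extend s y).2 ?_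
      rintro _ ⟨r, hr, rfl⟩
      refine ((hψ.left r).map_sup z hz s hs).2 ?_
      rintro _ ⟨n, rfl⟩
      exact (hψ.le_extend _ hr).trans (hc ⟨n, rfl⟩)

theorem isGenCuMorphism_extend_right (hq : q = q ^ 2) (hq1 : q ≠ 1)
    (hψ : IsRationalBimorphism ψ) (x : S) : IsGenCuMorphism (hψ.extend x) where
  map_zero := (hψ.extend_compact x 0).trans (hψ.map_zero x)
  map_add a b := by
    refine (hψ.isLUB_extend x (a + b)).unique ((hψ.hasCofinalSeq x a).isLUB_add
      (hψ.hasCofinalSeq x b) (hψ.isLUB_extend x a) (hψ.isLUB_extend x b) ?_ ?_)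
    · rintro _ ⟨r, hr, rfl⟩ _ ⟨s, hs, rfl⟩
      have hrs : CuUHF.compact r + CuUHF.compact s ≤ a + b := add_le_add hr hs
      exact ⟨r + s, hrs, hψ.map_add x r s⟩
    · rintro _ ⟨t, ht, rfl⟩
      obtain ⟨r, s, hr, hs, hle⟩ := CuUHF.exists_compact_add hq hq1 ht
      exact ⟨_, ⟨r, hr, rfl⟩, _, ⟨s, hs, rfl⟩, hψ.map_add x r s ▸ hψ.monotone x hle⟩
  monotone y y' h := (hψ.isLUB_extend x y).mono (hψ.isLUB_extend x y')
    (Set.image_mono fun _ hr => le_trans hr h)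
  map_sup z hz s hs := by
    constructor
    · rintro _ ⟨n, rfl⟩
      exact (hψ.isLUB_extend x _).mono (hψ.isLUB_extend x s)
        (Set.image_mono fun _ hr => le_trans hr (hs.1 ⟨n, rfl⟩))
    · intro c hc
      refine (hψ.isLUB_extend x s).2 ?_
      rintro _ ⟨r, hr, rfl⟩
      -- Compactness of `r`: if it lies below the supremum, it lies below some `z n`.
      obtain ⟨n, hn⟩ := CuUHF.wayBelow_compact (le_refl (CuUHF.compact r)) z hz s hs hr
      exact (hψ.le_extend x hn).trans (hc ⟨n, rfl⟩)

theorem isGenCuBimorphism_extend (hq : q = q ^ 2) (hq1 : q ≠ 1)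
    (hψ : IsRationalBimorphism ψ) : IsGenCuBimorphism hψ.extend :=
  ⟨hψ.isGenCuMorphism_extend_left, hψ.isGenCuMorphism_extend_right hq hq1⟩

/-- For a compact `r` between `y'` and `y`, the elements `ψ x' r ≪ ψ x r` separate the two values,
so only `≪` in the first variable is needed. -/
theorem wayBelow_extend (hq : q = q ^ 2) (hq1 : q ≠ 1) (hψ : IsRationalBimorphism ψ)
    (hw : ∀ x' x r, WayBelow x' x → WayBelow (ψ x' r) (ψ x r)) {x' x : S} {y' y : CuUHF q}
    (hx : WayBelow x' x) (hy : WayBelow y' y) :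
    WayBelow (hψ.extend x' y') (hψ.extend x y) := by
  obtain ⟨r, hr, hr'⟩ := CuUHF.exists_compact_between hq hq1 hy
  refine ((hw x' x r hx).of_le_right (hψ.le_extend x hr')).of_le_left ?_
  rw [← hψ.extend_compact]
  exact (hψ.isGenCuMorphism_extend_right hq hq1 x').monotone hr

end IsRationalBimorphism

end Extend

/-! # The action of `K_q` through a divisible and an unperforated morphism -/

section Rational

variable {q : Supernatural} {S₁ : Type u} {S₂ : Type v} {T : Type w} [CuSemigroup S₁]
  [CuSemigroup S₂] [CuSemigroup T] {φ₁ : S₁ → S₂} {φ₂ : S₂ → T}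

/-- The element `φ₂ (k • y)`, where `r = k / n` and `φ₁ x = n • y`. -/
noncomputable def rationalMul (φ₂ : S₂ → T) (hdiv : IsQDivisible q φ₁) (x : S₁)
    (r : UHFRational q) : T :=
  φ₂ ((r : ℚ≥0).num • (hdiv x _ r.2).choose)

/-- Multiplying by `n * n'` clears both denominators; this product divides `q` because `q = q²`. -/
theorem IsQUnperforated.map_nsmul_le (hq : q = q ^ 2) (hunp : IsQUnperforated q φ₂)
    {n n' : ℕ} (hn : Supernatural.IsDivisor n q) (hn' : Supernatural.IsDivisor n' q)
    {y y' : S₂} (hy : n • y ≤ n' • y') {k k' : ℕ} (hk : k * n' ≤ k' * n) :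
    φ₂ (k • y) ≤ φ₂ (k' • y') := by
  refine hunp _ _ _ (hn.mul hq hn') ?_
  calc (n * n') • k • y = (k * n') • n • y := by simp only [smul_smul]; congr 1; ring
    _ ≤ (k * n') • n' • y' := nsmul_le_nsmul_right hy _
    _ ≤ (k' * n) • n' • y' := nsmul_le_nsmul_left (CuSemigroup.zero_le' _) hk
    _ = (n * n') • k' • y' := by simp only [smul_smul]; congr 1; ring

/-- The preceding comparison, applied in both directions, removes the dependence on the chosen
quotient. Allowing unreduced `k / n` makes common denominators possible. -/
theorem rationalMul_eq (hq : q = q ^ 2) (hdiv : IsQDivisible q φ₁)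
    (hunp : IsQUnperforated q φ₂) {x : S₁} {r : UHFRational q} {n k : ℕ} {y : S₂}
    (hn : Supernatural.IsDivisor n q) (hy : φ₁ x = n • y) (hr : (r : ℚ≥0) * n = k) :
    rationalMul φ₂ hdiv x r = φ₂ (k • y) := by
  have hy' := (hdiv x _ r.2).choose_spec
  have h : (r : ℚ≥0).num * n = k * (r : ℚ≥0).den := by
    have h₁ := NNRat.num_div_den (r : ℚ≥0)
    have h₂ : ((r : ℚ≥0).den : ℚ≥0) ≠ 0 := by exact_mod_cast (r : ℚ≥0).den_ne_zero
    rw [← h₁, div_mul_eq_mul_div, div_eq_iff h₂] at hr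
    exact_mod_cast hr
  exact le_antisymm (hunp.map_nsmul_le hq r.2 hn (hy'.symm.trans hy).le h.le)
    (hunp.map_nsmul_le hq hn r.2 (hy.symm.trans hy').le h.ge)

theorem rationalMul_one (hq : q = q ^ 2) (hdiv : IsQDivisible q φ₁)
    (hunp : IsQUnperforated q φ₂) (x : S₁) :
    rationalMul φ₂ hdiv x ⟨1, UHFRational.one_mem q⟩ = φ₂ (φ₁ x) := by
  rw [rationalMul_eq hq hdiv hunp (n := 1) (k := 1) (UHFRational.one_mem q)
    (one_nsmul (φ₁ x)).symm (by simp), one_nsmul]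

/-- If `n • b` is the supremum of the increasing sequence `n • y m`, then `φ₂ b` is the supremum
of the `φ₂ (y m)`. -/
theorem isLUB_of_nsmul (hφ₂ : IsGenCuMorphism φ₂) (hunp : IsQUnperforated q φ₂) {n : ℕ}
    (hn : Supernatural.IsDivisor n q) {y : ℕ → S₂} {b : S₂} (hy : Monotone fun m => n • y m)
    (h : IsLUB (Set.range fun m => n • y m) (n • b)) :
    IsLUB (Set.range fun m => φ₂ (y m)) (φ₂ b) := by
  constructor
  · rintro _ ⟨m, rfl⟩
    exact hunp _ _ n hn (h.1 ⟨m, rfl⟩)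
  · intro c hc
    -- The `y m` may fail to increase in `S₂`, so `b` is approximated from within: `z j ≪ b` gives
    -- `n • z j ≪ n • b`, hence `n • z j ≤ n • y m` for some `m`, and unperforation removes `n`.
    obtain ⟨z, hz, -, hzb, hzl⟩ := CuSemigroup.exists_seq b
    refine (hφ₂.map_sup z hz b hzl).2 ?_
    rintro _ ⟨j, rfl⟩
    obtain ⟨m, hm⟩ := (hzb j).nsmul n _ hy _ h le_rfl
    exact (hunp _ _ n hn hm).trans (hc ⟨m, rfl⟩)

theorem isGenCuMorphism_nsmul (k : ℕ) : IsGenCuMorphism fun x : T => k • x where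
  map_zero := smul_zero k
  map_add := smul_add k
  monotone _ _ h := nsmul_le_nsmul_right h k
  map_sup z hz s hs := by
    induction k with
    | zero => simp
    | succ k ih =>
      simp only [succ_nsmul]
      exact CuSemigroup.O4 _ _ (fun _ _ h => nsmul_le_nsmul_right (hz h) k) hz _ _ ih hs

theorem isRationalBimorphism_rationalMul (hq : q = q ^ 2) (hφ₁ : IsGenCuMorphism φ₁)
    (hφ₂ : IsGenCuMorphism φ₂) (hdiv : IsQDivisible q φ₁) (hunp : IsQUnperforated q φ₂) :
    IsRationalBimorphism (rationalMul φ₂ hdiv) where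
  left r := by
    have hr : (r : ℚ≥0) * (r : ℚ≥0).den = (r : ℚ≥0).num := NNRat.mul_den_eq_num _
    choose y hy using fun x => hdiv x _ r.2
    -- Pulling out the numerator reduces order and suprema to the action of `1 / n`.
    have hval : ∀ x, rationalMul φ₂ hdiv x r = (r : ℚ≥0).num • φ₂ (y x) := fun x => by
      rw [rationalMul_eq hq hdiv hunp r.2 (hy x) hr, hφ₂.map_nsmul]
    refine ⟨?_, fun a b => ?_, fun a b h => ?_, fun z hz s hs => ?_⟩
    · rw [rationalMul_eq (y := 0) hq hdiv hunp r.2 (by rw [hφ₁.map_zero, smul_zero]) hr,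
        smul_zero, hφ₂.map_zero]
    · have hab : φ₁ (a + b) = (r : ℚ≥0).den • (y a + y b) := by
        rw [hφ₁.map_add, smul_add, ← hy, ← hy]
      rw [rationalMul_eq hq hdiv hunp r.2 hab hr, hφ₂.map_nsmul, hφ₂.map_add, smul_add,
        hval, hval]
    · simp only [hval]
      refine nsmul_le_nsmul_right (hunp _ _ _ r.2 ?_) _
      rw [← hy, ← hy]
      exact hφ₁.monotone h
    · simp only [hval]
      have hlub := hφ₁.map_sup z hz s hs
      have hmono := hφ₁.monotone.comp hz
      simp only [Function.comp_def, hy] at hlub hmono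
      refine (isGenCuMorphism_nsmul (r : ℚ≥0).num).map_sup _ (fun i j h => ?_) _
        (isLUB_of_nsmul hφ₂ hunp r.2 hmono hlub)
      exact hunp _ _ _ r.2 (hmono h)
  map_zero x := by
    have h0 : Supernatural.IsDivisor 1 q := UHFRational.one_mem q
    rw [rationalMul_eq (k := 0) hq hdiv hunp h0 (one_nsmul (φ₁ x)).symm (by simp), zero_smul,
      hφ₂.map_zero]
  map_add x r s := by
    -- The product of the denominators is a common denominator dividing `q`; one quotient `y` then
    -- computes all three values.
    have hn := r.2.mul hq s.2
    obtain ⟨y, hy⟩ := hdiv x _ hn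
    have hr := NNRat.mul_den_eq_num (r : ℚ≥0)
    have hs := NNRat.mul_den_eq_num (s : ℚ≥0)
    have hr' : (r : ℚ≥0) * ((r : ℚ≥0).den * (s : ℚ≥0).den : ℕ) =
        ((r : ℚ≥0).num * (s : ℚ≥0).den : ℕ) := by
      push_cast
      rw [← mul_assoc, hr]
    have hs' : (s : ℚ≥0) * ((r : ℚ≥0).den * (s : ℚ≥0).den : ℕ) =
        ((s : ℚ≥0).num * (r : ℚ≥0).den : ℕ) := by
      push_cast
      rw [mul_left_comm, hs, mul_comm]
    rw [rationalMul_eq hq hdiv hunp hn hy hr', rationalMul_eq hq hdiv hunp hn hy hs',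
      ← hφ₂.map_add, ← add_smul]
    refine rationalMul_eq hq hdiv hunp hn hy ?_
    rw [AddSubmonoid.coe_add, add_mul, hr', hs', Nat.cast_add]
  monotone x r s h := by
    have hr := (hdiv x _ r.2).choose_spec
    have hs := (hdiv x _ s.2).choose_spec
    refine hunp.map_nsmul_le hq r.2 s.2 (hr.symm.trans hs).le ?_
    have h' : (r : ℚ≥0) ≤ s := h
    rw [NNRat.le_def] at h'
    exact h'

/-- From `n • y' ≪ n • y` one cannot cancel `n`, but `n • y' ≤ n • z m` for some `z m ≪ y`. Hence
`φ₂ y' ≤ φ₂ (z m) ≪ φ₂ y`. -/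
theorem wayBelow_rationalMul (hφ₁ : IsCuMorphism φ₁) (hφ₂ : IsCuMorphism φ₂)
    (hdiv : IsQDivisible q φ₁) (hunp : IsQUnperforated q φ₂) {x' x : S₁} (r : UHFRational q)
    (h : WayBelow x' x) :
    WayBelow (rationalMul φ₂ hdiv x' r) (rationalMul φ₂ hdiv x r) := by
  have hy' := (hdiv x' _ r.2).choose_spec
  have hy := (hdiv x _ r.2).choose_spec
  have hw := hφ₁.map_wayBelow _ _ h
  rw [hy, hy'] at hw
  rw [rationalMul, rationalMul, hφ₂.map_nsmul, hφ₂.map_nsmul]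
  refine WayBelow.nsmul ?_ _
  obtain ⟨z, hz, -, hzy, hzl⟩ := CuSemigroup.exists_seq (hdiv x _ r.2).choose
  obtain ⟨m, hm⟩ := hw _ (fun _ _ h => nsmul_le_nsmul_right (hz h) _) _
    ((isGenCuMorphism_nsmul (r : ℚ≥0).den).map_sup z hz _ hzl) le_rfl
  exact (hφ₂.map_wayBelow _ _ (hzy m)).of_le_left (hunp _ _ _ r.2 hm)

end Rational

/-! ### Assembly: one map serves both assertions -/

theorem mainTheorem6 (q : Supernatural) (hq : q = q ^ 2) (hq1 : q ≠ 1)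
    {S₁ : Type u} {S₂ : Type v} {T : Type w} [CuSemigroup S₁] [CuSemigroup S₂] [CuSemigroup T]
    (φ₁ : S₁ → S₂) (φ₂ : S₂ → T) (hφ₁ : IsGenCuMorphism φ₁) (hφ₂ : IsGenCuMorphism φ₂)
    (hdiv : IsQDivisible q φ₁) (hunp : IsQUnperforated q φ₂) :
    (∃ γ : CuTensor S₁ (CuUHF q) → T, IsGenCuMorphism γ ∧
      ∀ x : S₁, γ (CuTensor.tmul x 1) = φ₂ (φ₁ x)) ∧
    (IsCuMorphism φ₁ → IsCuMorphism φ₂ →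
      ∃ γ : CuTensor S₁ (CuUHF q) → T, IsCuMorphism γ ∧
        ∀ x : S₁, γ (CuTensor.tmul x 1) = φ₂ (φ₁ x)) := by
  have hψ := isRationalBimorphism_rationalMul hq hφ₁ hφ₂ hdiv hunp
  have hβ := hψ.isGenCuBimorphism_extend hq hq1
  have hone : ∀ x, CuTensor.lift hβ (CuTensor.tmul x 1) = φ₂ (φ₁ x) := fun x =>
    (CuTensor.lift_tmul hβ x 1).trans
      ((hψ.extend_compact x _).trans (rationalMul_one hq hdiv hunp x))
  refine ⟨⟨_, CuTensor.isGenCuMorphism_lift hβ, hone⟩, fun h₁ h₂ =>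
    ⟨_, CuTensor.isCuMorphism_lift hβ fun x' x y' y hx hy => ?_, hone⟩⟩
  exact hψ.wayBelow_extend hq hq1 (fun _ _ r h => wayBelow_rationalMul h₁ h₂ hdiv hunp r h) hx hy
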